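/- Let $\mathcal{L}=\{f,R,0,1\}$ be the language with a ternary function symbol $f$, a binary relation symbol $R$ and two constant symbols $0,1$. Let $\mathcal{M}$ be the $\mathcal{L}$-structure whose universe is the disjoint union $M=\mathbb{Q}\cup\mathbb{Q}^2$, in which $0,1$ denote the corresponding elements of $\mathbb{Q}$, $R^{\mathcal{M}}=\{(p,(p,q)) : p,q\in\mathbb{Q}\}$, and, for $p,q,r,s\in\mathbb{Q}$, $$f^{\mathcal{M}}(p,q,r)=(q-p)+r,\qquad f^{\mathcal{M}}((s,p),(s,q),(s,r))=(s,(q-p)+r),\qquad f^{\mathcal{M}}(p,(p,q),r)=(p,(q-p)+r),$$ while $f^{\mathcal{M}}(a,b,c)=c$ for all other triples $(a,b,c)\in M^3$. Then $\mathcal{M}$ is countable, and: 1. $\operatorname{Th}(\mathcal{M})$ is uncountably categorical: for every uncountable cardinal $\kappa$ it has exactly one model of cardinality $\kappa$ up to isomorphism. 2. $\mathcal{M}$ is the prime model of $\operatorname{Th}(\mathcal{M})$: it embeds elementarily into every model of $\operatorname{Th}(\mathcal{M})$. 3. $\operatorname{Aut}(\mathcal{M})$, with the topology of pointwise convergence on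 the discrete set $M$, is not locally (OB): no open neighborhood of the identity has finite diameter with respect to every continuous left-invariant pseudometric on $\operatorname{Aut}(\mathcal{M})$. In particular, there is a countable structure whose theory is uncountably categorical, which is the prime model of its theory, and whose automorphism group is not locally (OB). -/

import Mathlib

universe u v w x

open scoped FirstOrder

/-! ### Coarse notions for topological groups -/

/-- `d` is a continuous, left-invariant pseudometric on the topological group `G`. -/
structure IsContinuousLeftInvariantPseudometric {G : Type u} [Group G] [TopologicalSpace G]
    (d : G → G → ℝ) : Prop where
  dist_self : ∀ x, d x x = 0
  dist_comm : ∀ x y, d x y = d y x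
  dist_triangle : ∀ x y z, d x z ≤ d x y + d y z
  left_invariant : ∀ g x y, d (g * x) (g * y) = d x y
  continuous : Continuous (fun p : G × G => d p.1 p.2)

/-- A subset of a topological group has the relative property (OB) if it has finite diameter
with respect to every continuous, left-invariant pseudometric on the group. -/
def HasRelativeOB {G : Type u} [Group G] [TopologicalSpace G] (A : Set G) : Prop :=
  ∀ d : G → G → ℝ, IsContinuousLeftInvariantPseudometric d →
    ∃ C : ℝ, ∀ x ∈ A, ∀ y ∈ A, d x y ≤ C

/-- A topological group is locally (OB) if the identity has an open neighborhood with the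
relative property (OB). -/
def IsLocallyOB (G : Type u) [Group G] [TopologicalSpace G] : Prop :=
  ∃ U : Set G, IsOpen U ∧ 1 ∈ U ∧ HasRelativeOB U

/-! ### Model-theoretic notions -/

namespace FirstOrder.Language

/-- The automorphisms of a first-order structure form a group under composition. -/
instance autGroup {L : Language.{u, v}} {M : Type w} [L.Structure M] : Group (M ≃[L] M) where
  mul g h := g.comp h
  one := Equiv.refl L M
  inv g := g.symm
  mul_assoc _ _ _ := rfl
  one_mul _ := rfl
  mul_one _ := rfl
  inv_mul_cancel g := Equiv.symm_comp_self g

/-- The automorphism group of a structure carries the topology of pointwise convergence,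
where the structure itself is discrete. -/
instance autTopology {L : Language.{u, v}} {M : Type w} [L.Structure M] :
    TopologicalSpace (M ≃[L] M) :=
  TopologicalSpace.induced (fun (g : M ≃[L] M) (a : M) => g a)
    (@Pi.topologicalSpace M (fun _ => M) (fun _ => ⊥))

/-- A theory is uncountably categorical if, for every uncountable cardinal `κ`, it has exactly one
model of cardinality `κ` up to isomorphism. -/
def IsUncountablyCategorical {L : Language.{u, v}} (T : L.Theory) : Prop :=
  ∀ κ : Cardinal.{w}, Cardinal.aleph0 < κ →
    (∃ N : Theory.ModelType.{u, v, w} T, Cardinal.mk N = κ) ∧ κ.Categorical T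

/-- A prime model of a theory is a model that embeds elementarily in every model of it. -/
def IsPrimeModel {L : Language.{u, v}} (T : L.Theory) (M : Type x) [L.Structure M] : Prop :=
  M ⊨ T ∧ ∀ N : Theory.ModelType.{u, v, w} T, Nonempty (M ↪ₑ[L] N)

end FirstOrder.Language

/-! ### The structure -/

namespace ParentChild

/-- The function symbols: constants `0`, `1`, and a ternary symbol `f`. -/
inductive Func : ℕ → Type
  | zero : Func 0
  | one : Func 0
  | f : Func 3

/-- The only relation symbol is the binary symbol `R`. -/
inductive Rel : ℕ → Type
  | R : Rel 2

/-- The language `{f, R, 0, 1}`. -/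
def lang : FirstOrder.Language.{0, 0} where
  Functions := Func
  Relations := Rel

/-- The universe of the structure is the disjoint union of `ℚ` and `ℚ²`. -/
inductive Carrier : Type
  | parent (p : ℚ) : Carrier
  | child (p q : ℚ) : Carrier

open Carrier

/-- The interpretation of `f`. -/
def fInterp : Carrier → Carrier → Carrier → Carrier
  | parent p, parent q, parent r => parent ((q - p) + r)
  | child s p, child s' q, child s'' r =>
      if s = s' ∧ s = s'' then child s ((q - p) + r) else child s'' r
  | parent p, child p' q, parent r => if p = p' then child p ((q - p) + r) else parent r
  | _, _, c => c

/-- The interpretation of `R`: the pairs `(p, (p, q))` with `p, q ∈ ℚ`. -/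
def rInterp (a b : Carrier) : Prop := ∃ p q : ℚ, a = parent p ∧ b = child p q

instance structureCarrier : lang.Structure Carrier where
  funMap := fun {_} s =>
    match s with
    | Func.zero => fun _ => parent 0
    | Func.one => fun _ => parent 1
    | Func.f => fun v => fInterp (v 0) (v 1) (v 2)
  RelMap := fun {_} s =>
    match s with
    | Rel.R => fun v => rInterp (v 0) (v 1)

end ParentChild

/-!
Write `0`, `1`, `f`, `R` also for the interpretations in a model `N` of the theory. The parents
`V` of `N` form a rational vector space under `x + y = f(0, x, y)`, in which `1` is a nonzero
vector, and the children of every parent are a torsor under `V`. These facts are first-order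
(`IsParentChild`), hence pass from the concrete structure to `N`. After the choice of one child of
every parent, `N` is the structure `Std V 1` with universe `V ⊕ V × V`, on which `f` and `R` are
given by the formulas of the concrete structure (`nonempty_std_equiv`). So `N` is determined by the
pair `(V, 1)`, up to isomorphism.

If `N` is uncountable, then `dim V = |V| = |N|`, and linear automorphisms act transitively on
nonzero vectors; this gives categoricity, while models of every infinite cardinality exist by the
Löwenheim-Skolem theorem.

The rational multiples of `1` give an embedding of the concrete structure in every `N`. It is
elementary because orbits of finite tuples in the concrete structure are isolated: every parent `p`
is definable by an equation `n · p + m · 1 = k · 1`, and two children `(s, q)`, `(s, r)` are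
determined up to a common translation by `f(s, (s, q), r - q + s) = (s, r)`, where
independent translations of the sets of children are automorphisms (`exists_formula_orbit`). Hence a
formula true at a tuple follows from its isolating formula in the concrete structure, so
in `N` too.

The automorphisms of the concrete structure are exactly these translations, so that its automorphism
group is the product of countably many copies of the discrete group `ℚ`. Every neighbourhood of the
identity contains a full factor, and this factor is unbounded for the pseudometric which
compares the translation lengths there.
-/

namespace ParentChild

open FirstOrder Language Carrier

/-! ### Symbols, terms and atomic formulas -/

/-- `Func.f` as a symbol of `lang`. -/
def opSymbol : lang.Functions 3 := Func.f

/-- `Func.zero` as a symbol of `lang`. -/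
def zeroSymbol : lang.Functions 0 := Func.zero

/-- `Func.one` as a symbol of `lang`. -/
def oneSymbol : lang.Functions 0 := Func.one

/-- `Rel.R` as a symbol of `lang`. -/
def childSymbol : lang.Relations 2 := Rel.R

section Operations

variable {N : Type*} [lang.Structure N] {α : Type*}

/-- The interpretation of the ternary function symbol, as a curried function. -/
def op (a b c : N) : N := Structure.funMap opSymbol ![a, b, c]

/-- The interpretation of the relation symbol: `b` is a child of `a`. -/
def IsChildOf (a b : N) : Prop := Structure.RelMap childSymbol ![a, b]

variable (N) in
/-- The interpretation of the constant symbol `0`. -/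
def zeroElt : N := Structure.funMap zeroSymbol ![]

variable (N) in
/-- The interpretation of the constant symbol `1`. -/
def oneElt : N := Structure.funMap oneSymbol ![]

/-- A quantifier-free definition of the sort of parents, uniform in all structures: for
`x` in the concrete structure, `f(0, 1, x) = x` exactly if `x` is a child. -/
def IsParent (x : N) : Prop := op (zeroElt N) (oneElt N) x ≠ x

/-- The term for `op`. -/
def opTerm (s t r : lang.Term α) : lang.Term α := Term.func opSymbol ![s, t, r]

/-- The term for `zeroElt`. -/
def zeroTerm : lang.Term α := Term.func zeroSymbol ![]

/-- The term for `oneElt`. -/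
def oneTerm : lang.Term α := Term.func oneSymbol ![]

/-- The formula for `IsChildOf`. -/
def childFormula (s t : lang.Term α) : lang.Formula α :=
  childSymbol.formula ![s, t]

/-- The formula for `IsParent`. -/
def parentFormula (s : lang.Term α) : lang.Formula α :=
  ((opTerm zeroTerm oneTerm s).equal s).not

@[simp]
theorem realize_opTerm (s t r : lang.Term α) (v : α → N) :
    (opTerm s t r).realize v = op (s.realize v) (t.realize v) (r.realize v) := by
  simp only [opTerm, op, Term.realize_func]
  congr 1
  funext i
  fin_cases i <;> rfl

@[simp]
theorem realize_zeroTerm (v : α → N) : (zeroTerm : lang.Term α).realize v = zeroElt N := by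
  simp only [zeroTerm, zeroElt, Term.realize_func]
  congr 1
  exact Subsingleton.elim _ _

@[simp]
theorem realize_oneTerm (v : α → N) : (oneTerm : lang.Term α).realize v = oneElt N := by
  simp only [oneTerm, oneElt, Term.realize_func]
  congr 1
  exact Subsingleton.elim _ _

@[simp]
theorem realize_childFormula (s t : lang.Term α) (v : α → N) :
    (childFormula s t).Realize v ↔ IsChildOf (s.realize v) (t.realize v) := by
  rw [childFormula, Formula.realize_rel, IsChildOf]
  suffices h : (fun i => (![s, t] i).realize v) = ![s.realize v, t.realize v] by rw [h]
  funext i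
  fin_cases i <;> rfl

@[simp]
theorem realize_parentFormula (s : lang.Term α) (v : α → N) :
    (parentFormula s).Realize v ↔ IsParent (s.realize v) := by
  simp [parentFormula, IsParent]

/-- The term `n · s + t`, with `f(0, x, y)` as `x + y`. -/
def mulAddTerm (n : ℕ) (s t : lang.Term α) : lang.Term α := (opTerm zeroTerm s)^[n] t

@[simp]
theorem realize_mulAddTerm (n : ℕ) (s t : lang.Term α) (v : α → N) :
    (mulAddTerm n s t).realize v = (op (zeroElt N) (s.realize v))^[n] (t.realize v) := by
  induction n with
  | zero => rfl
  | succ n ih =>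
    simp only [mulAddTerm] at ih
    simp only [mulAddTerm, Function.iterate_succ_apply', realize_opTerm, realize_zeroTerm, ih]

end Operations

/-! ### The axioms of parent-child structures -/

/-- First-order axioms satisfied by the concrete structure. The parents form a nontrivial
torsion-free divisible abelian group under `a + b = f(0, a, b)`, with `f(a, b, c) = b - a + c`. The
children of a parent `x` are a torsor under this group, with `z` sending a child `y` of `x` to
`f(x, y, z + x)`, and `f` is also `b - a + c` on these children. In the two axiom schemes the
multiplier is `n + 1`, so that it is nonzero. -/
class IsParentChild (N : Type*) [lang.Structure N] : Prop where
  zero_ne_one : zeroElt N ≠ oneElt N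
  isParent_zero : IsParent (zeroElt N)
  isParent_one : IsParent (oneElt N)
  isParent_op (a b c : N) : IsParent a → IsParent b → IsParent c → IsParent (op a b c)
  zero_add (a : N) : IsParent a → op (zeroElt N) (zeroElt N) a = a
  add_comm (a b : N) : IsParent a → IsParent b → op (zeroElt N) a b = op (zeroElt N) b a
  add_assoc (a b c : N) : IsParent a → IsParent b → IsParent c →
    op (zeroElt N) (op (zeroElt N) a b) c = op (zeroElt N) a (op (zeroElt N) b c)
  neg_add (a : N) : IsParent a → op (zeroElt N) (op a (zeroElt N) (zeroElt N)) a = zeroElt N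
  op_parents (a b c : N) : IsParent a → IsParent b → IsParent c →
    op a b c = op (zeroElt N) (op (zeroElt N) b (op a (zeroElt N) (zeroElt N))) c
  divisible (n : ℕ) (a : N) : IsParent a →
    ∃ b, IsParent b ∧ (op (zeroElt N) b)^[n + 1] (zeroElt N) = a
  torsionFree (n : ℕ) (a : N) : IsParent a →
    (op (zeroElt N) a)^[n + 1] (zeroElt N) = zeroElt N → a = zeroElt N
  isParent_of_isChildOf (x y : N) : IsChildOf x y → IsParent x
  not_isParent_of_isChildOf (x y : N) : IsChildOf x y → ¬ IsParent y
  parent_unique (x x' y : N) : IsChildOf x y → IsChildOf x' y → x = x'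
  exists_parent (y : N) : ¬ IsParent y → ∃ x, IsChildOf x y
  exists_child (x : N) : IsParent x → ∃ y, IsChildOf x y
  isChildOf_op (x y z : N) : IsChildOf x y → IsParent z → IsChildOf x (op x y z)
  op_self (x y : N) : IsChildOf x y → op x y x = y
  op_op (x y z t : N) : IsChildOf x y → IsParent z → IsParent t →
    op x (op x y z) t = op x y (op x z t)
  op_injective (x y z t : N) : IsChildOf x y → IsParent z → IsParent t →
    op x y z = op x y t → z = t
  op_transitive (x y y' : N) : IsChildOf x y → IsChildOf x y' → ∃ z, IsParent z ∧ op x y z = y'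
  op_children (x y y' z : N) : IsChildOf x y → IsChildOf x y' → IsParent z →
    op y (op x y z) y' = op x y' z
  op_parent_parent_child (a b c : N) : IsParent a → IsParent b → ¬ IsParent c → op a b c = c
  op_parent_child_child (a b c : N) : IsParent a → ¬ IsParent b → ¬ IsParent c → op a b c = c
  op_not_isChildOf (a b c : N) : IsParent a → ¬ IsParent b → IsParent c → ¬ IsChildOf a b →
    op a b c = c
  op_child_parent (a b c : N) : ¬ IsParent a → IsParent b → op a b c = c
  op_child_child_parent (a b c : N) : ¬ IsParent a → ¬ IsParent b → IsParent c → op a b c = c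
  op_not_siblings (x a b c : N) : ¬ IsParent a → ¬ IsParent b → IsChildOf x c →
    ¬ (IsChildOf x a ∧ IsChildOf x b) → op a b c = c

/-! ### The concrete structure -/

@[simp]
theorem zeroElt_carrier : zeroElt Carrier = parent 0 := rfl

@[simp]
theorem oneElt_carrier : oneElt Carrier = parent 1 := rfl

theorem op_carrier (a b c : Carrier) : op a b c = fInterp a b c := rfl

@[simp]
theorem isChildOf_parent_child (p s q : ℚ) :
    IsChildOf (parent p) (child s q) ↔ p = s := by
  change rInterp _ _ ↔ _
  simp [rInterp, eq_comm]

@[simp]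
theorem not_isChildOf_parent (a : Carrier) (p : ℚ) : ¬ IsChildOf a (parent p) := by
  change ¬ rInterp _ _
  simp [rInterp]

@[simp]
theorem not_child_isChildOf (p q : ℚ) (a : Carrier) : ¬ IsChildOf (child p q) a := by
  change ¬ rInterp _ _
  simp [rInterp]

@[simp]
theorem isParent_parent (p : ℚ) : IsParent (parent p) := by
  simp [IsParent, op_carrier, fInterp]

@[simp]
theorem not_isParent_child (p q : ℚ) : ¬ IsParent (child p q) := by
  simp [IsParent, op_carrier, fInterp]

@[simp]
theorem op_parents_carrier (p q r : ℚ) :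
    op (parent p) (parent q) (parent r) = parent (q - p + r) := rfl

@[simp]
theorem op_parent_child_parent_carrier (p s q r : ℚ) :
    op (parent p) (child s q) (parent r) = if p = s then child p (q - p + r) else parent r := rfl

@[simp]
theorem op_children_carrier (s s' s'' p q r : ℚ) :
    op (child s p) (child s' q) (child s'' r) =
      if s = s' ∧ s = s'' then child s (q - p + r) else child s'' r := rfl

@[simp]
theorem op_parent_parent_child_carrier (p q s r : ℚ) :
    op (parent p) (parent q) (child s r) = child s r := rfl

@[simp]
theorem op_parent_child_child_carrier (p q t s r : ℚ) :
    op (parent p) (child q t) (child s r) = child s r := rfl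

@[simp]
theorem op_child_parent_carrier (p q t : ℚ) (c : Carrier) :
    op (child p q) (parent t) c = c := by cases c <;> rfl

@[simp]
theorem op_child_child_parent_carrier (p q s t r : ℚ) :
    op (child p q) (child s t) (parent r) = parent r := rfl

theorem iterate_op_carrier (n : ℕ) (p r : ℚ) :
    (op (parent 0) (parent p))^[n] (parent r) = parent (n * p + r) := by
  induction n with
  | zero => simp
  | succ n ih =>
    rw [Function.iterate_succ_apply', ih, op_parents_carrier]
    push_cast
    congr 1
    ring

instance isParentChild_carrier : IsParentChild Carrier where
  zero_ne_one := by simp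
  isParent_zero := by simp
  isParent_one := by simp
  isParent_op a b c := by cases a <;> cases b <;> cases c <;> simp
  zero_add a := by cases a <;> simp
  add_comm a b := by cases a <;> cases b <;> simp [_root_.add_comm]
  add_assoc a b c := by cases a <;> cases b <;> cases c <;> simp [_root_.add_assoc]
  neg_add a := by cases a <;> simp
  op_parents a b c := by cases a <;> cases b <;> cases c <;> simp [sub_eq_add_neg]
  divisible n a := by
    rcases a with p | _
    · intro _
      refine ⟨parent (p / (n + 1 : ℕ)), by simp, ?_⟩
      rw [zeroElt_carrier, iterate_op_carrier, add_zero, mul_div_cancel₀]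
      exact_mod_cast n.succ_ne_zero
    · simp
  torsionFree n a := by
    rcases a with p | _
    · rw [zeroElt_carrier, iterate_op_carrier]
      intro _ h
      have h' : ((n + 1 : ℕ) : ℚ) * p + 0 = 0 := by simpa only [Carrier.parent.injEq] using h
      rw [add_zero, mul_eq_zero] at h'
      rw [h'.resolve_left (by exact_mod_cast n.succ_ne_zero)]
    · simp
  isParent_of_isChildOf x y := by cases x <;> cases y <;> simp
  not_isParent_of_isChildOf x y := by cases x <;> cases y <;> simp
  parent_unique x x' y := by cases x <;> cases x' <;> cases y <;> simp +contextual
  exists_parent y := by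
    rcases y with p | ⟨s, q⟩
    · simp
    · exact fun _ => ⟨parent s, by simp⟩
  exists_child x := by
    rcases x with p | ⟨s, q⟩
    · exact fun _ => ⟨child p 0, by simp⟩
    · simp
  isChildOf_op x y z := by cases x <;> cases y <;> cases z <;> simp +contextual
  op_self x y := by cases x <;> cases y <;> simp +contextual
  op_op x y z t := by
    cases x <;> cases y <;> cases z <;> cases t <;> simp +contextual
    intros; ring
  op_injective x y z t := by
    cases x <;> cases y <;> cases z <;> cases t <;> simp +contextual
  op_transitive x y y' := by
    rcases x with x | _ <;> rcases y with _ | ⟨s, q⟩ <;> rcases y' with _ | ⟨s', q'⟩ <;> simp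
    rintro rfl rfl
    exact ⟨parent (q' - q + x), by simp⟩
  op_children x y y' z := by
    cases x <;> cases y <;> cases y' <;> cases z <;> simp +contextual
    intros; ring
  op_parent_parent_child a b c := by cases a <;> cases b <;> cases c <;> simp
  op_parent_child_child a b c := by cases a <;> cases b <;> cases c <;> simp
  op_not_isChildOf a b c := by cases a <;> cases b <;> cases c <;> simp
  op_child_parent a b c := by cases a <;> cases b <;> simp
  op_child_child_parent a b c := by cases a <;> cases b <;> cases c <;> simp
  op_not_siblings x a b c := by
    cases x <;> cases a <;> cases b <;> cases c <;> simp +contextual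
    intros; simp_all

/-! ### Models of the theory -/

section Transfer

variable {N : Type*} [lang.Structure N] {α : Type*}

/-- A formula that holds throughout the concrete structure holds throughout every model of its
theory. -/
theorem realize_of_forall_carrier [N ⊨ lang.completeTheory Carrier] (φ : lang.Formula α)
    (h : ∀ v : α → Carrier, φ.Realize v) (v : α → N) : φ.Realize v := by
  classical
  by_contra hv
  have hN : φ.not.exClosure.Realize N :=
    (Formula.realize_exClosure _).2 ⟨fun a => v a,
      (BoundedFormula.realize_restrictFreeVar (φ := φ.not) (f := id) (v := fun a => v a)
        (v' := v) (fun _ => rfl)).2 hv⟩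
  rw [realize_iff_of_model_completeTheory Carrier N] at hN
  obtain ⟨v₁, hv₁⟩ := (Formula.realize_exClosure _).1 hN
  -- The values of variables that do not occur in the formula are irrelevant.
  let v₂ : α → Carrier := fun a => if ha : a ∈ φ.not.freeVarFinset then v₁ ⟨a, ha⟩ else parent 0
  exact (BoundedFormula.realize_restrictFreeVar (φ := φ.not) (f := id) v₂
    (fun a => (show v₂ a = v₁ a from dif_pos a.2).symm)).1 hv₁ (h v₂)

end Transfer

local notation "𝟎" => zeroTerm
local notation "𝔵" => Term.var (L := lang)

instance isParentChild_of_model (N : Type*) [lang.Structure N] [N ⊨ lang.completeTheory Carrier] :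
    IsParentChild N where
  zero_ne_one := by
    have := realize_of_forall_carrier (N := N) (α := Empty) (𝟎.equal oneTerm).not
      (fun v => by simp) Empty.elim
    simpa using this
  isParent_zero := by
    have := realize_of_forall_carrier (N := N) (α := Empty) (parentFormula 𝟎)
      (fun v => by simp) Empty.elim
    simpa using this
  isParent_one := by
    have := realize_of_forall_carrier (N := N) (α := Empty) (parentFormula oneTerm)
      (fun v => by simp) Empty.elim
    simpa using this
  isParent_op a b c := by
    have := realize_of_forall_carrier (N := N) (α := Fin 3)
      ((parentFormula (𝔵 0)).imp ((parentFormula (𝔵 1)).imp ((parentFormula (𝔵 2)).imp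
        (parentFormula (opTerm (𝔵 0) (𝔵 1) (𝔵 2))))))
      (fun v => by simpa using IsParentChild.isParent_op _ _ _) ![a, b, c]
    simpa using this
  zero_add a := by
    have := realize_of_forall_carrier (N := N) (α := Fin 1)
      ((parentFormula (𝔵 0)).imp ((opTerm 𝟎 𝟎 (𝔵 0)).equal (𝔵 0)))
      (fun v => by simpa using IsParentChild.zero_add (v 0)) ![a]
    simpa using this
  add_comm a b := by
    have := realize_of_forall_carrier (N := N) (α := Fin 2)
      ((parentFormula (𝔵 0)).imp ((parentFormula (𝔵 1)).imp
        ((opTerm 𝟎 (𝔵 0) (𝔵 1)).equal (opTerm 𝟎 (𝔵 1) (𝔵 0)))))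
      (fun v => by simpa using IsParentChild.add_comm (v 0) (v 1)) ![a, b]
    simpa using this
  add_assoc a b c := by
    have := realize_of_forall_carrier (N := N) (α := Fin 3)
      ((parentFormula (𝔵 0)).imp ((parentFormula (𝔵 1)).imp ((parentFormula (𝔵 2)).imp
        ((opTerm 𝟎 (opTerm 𝟎 (𝔵 0) (𝔵 1)) (𝔵 2)).equal (opTerm 𝟎 (𝔵 0) (opTerm 𝟎 (𝔵 1) (𝔵 2)))))))
      (fun v => by simpa using IsParentChild.add_assoc (v 0) (v 1) (v 2)) ![a, b, c]
    simpa using this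
  neg_add a := by
    have := realize_of_forall_carrier (N := N) (α := Fin 1)
      ((parentFormula (𝔵 0)).imp ((opTerm 𝟎 (opTerm (𝔵 0) 𝟎 𝟎) (𝔵 0)).equal 𝟎))
      (fun v => by simpa using IsParentChild.neg_add (v 0)) ![a]
    simpa using this
  op_parents a b c := by
    have := realize_of_forall_carrier (N := N) (α := Fin 3)
      ((parentFormula (𝔵 0)).imp ((parentFormula (𝔵 1)).imp ((parentFormula (𝔵 2)).imp
        ((opTerm (𝔵 0) (𝔵 1) (𝔵 2)).equal (opTerm 𝟎 (opTerm 𝟎 (𝔵 1) (opTerm (𝔵 0) 𝟎 𝟎)) (𝔵 2))))))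
      (fun v => by simpa using IsParentChild.op_parents (v 0) (v 1) (v 2)) ![a, b, c]
    simpa using this
  divisible n a := by
    have := realize_of_forall_carrier (N := N) (α := Fin 1)
      ((parentFormula (𝔵 0)).imp (Formula.iExs (Fin 1)
        (parentFormula (𝔵 (.inr 0)) ⊓ (mulAddTerm (n + 1) (𝔵 (.inr 0)) 𝟎).equal (𝔵 (.inl 0)))))
      (fun v => by
        simpa [Formula.realize_iExs, Fin.exists_fin_succ_pi, Fin.exists_fin_zero_pi,
          -zeroElt_carrier] using IsParentChild.divisible n (v 0)) ![a]
    simpa [Formula.realize_iExs, Fin.exists_fin_succ_pi, Fin.exists_fin_zero_pi] using this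
  torsionFree n a := by
    have := realize_of_forall_carrier (N := N) (α := Fin 1)
      ((parentFormula (𝔵 0)).imp (((mulAddTerm (n + 1) (𝔵 0) 𝟎).equal 𝟎).imp ((𝔵 0).equal 𝟎)))
      (fun v => by simpa using IsParentChild.torsionFree n (v 0)) ![a]
    simpa using this
  isParent_of_isChildOf x y := by
    have := realize_of_forall_carrier (N := N) (α := Fin 2)
      ((childFormula (𝔵 0) (𝔵 1)).imp (parentFormula (𝔵 0)))
      (fun v => by simpa using IsParentChild.isParent_of_isChildOf (v 0) (v 1)) ![x, y]
    simpa using this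
  not_isParent_of_isChildOf x y := by
    have := realize_of_forall_carrier (N := N) (α := Fin 2)
      ((childFormula (𝔵 0) (𝔵 1)).imp (parentFormula (𝔵 1)).not)
      (fun v => by simpa using IsParentChild.not_isParent_of_isChildOf (v 0) (v 1)) ![x, y]
    simpa using this
  parent_unique x x' y := by
    have := realize_of_forall_carrier (N := N) (α := Fin 3)
      ((childFormula (𝔵 0) (𝔵 2)).imp ((childFormula (𝔵 1) (𝔵 2)).imp ((𝔵 0).equal (𝔵 1))))
      (fun v => by simpa using IsParentChild.parent_unique (v 0) (v 1) (v 2)) ![x, x', y]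
    simpa using this
  exists_parent y := by
    have := realize_of_forall_carrier (N := N) (α := Fin 1)
      ((parentFormula (𝔵 0)).not.imp
        (Formula.iExs (Fin 1) (childFormula (𝔵 (.inr 0)) (𝔵 (.inl 0)))))
      (fun v => by
        simpa [Formula.realize_iExs, Fin.exists_fin_succ_pi, Fin.exists_fin_zero_pi] using
          IsParentChild.exists_parent (v 0)) ![y]
    simpa [Formula.realize_iExs, Fin.exists_fin_succ_pi, Fin.exists_fin_zero_pi] using this
  exists_child x := by
    have := realize_of_forall_carrier (N := N) (α := Fin 1)
      ((parentFormula (𝔵 0)).imp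
        (Formula.iExs (Fin 1) (childFormula (𝔵 (.inl 0)) (𝔵 (.inr 0)))))
      (fun v => by
        simpa [Formula.realize_iExs, Fin.exists_fin_succ_pi, Fin.exists_fin_zero_pi] using
          IsParentChild.exists_child (v 0)) ![x]
    simpa [Formula.realize_iExs, Fin.exists_fin_succ_pi, Fin.exists_fin_zero_pi] using this
  isChildOf_op x y z := by
    have := realize_of_forall_carrier (N := N) (α := Fin 3)
      ((childFormula (𝔵 0) (𝔵 1)).imp ((parentFormula (𝔵 2)).imp
        (childFormula (𝔵 0) (opTerm (𝔵 0) (𝔵 1) (𝔵 2)))))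
      (fun v => by simpa using IsParentChild.isChildOf_op (v 0) (v 1) (v 2)) ![x, y, z]
    simpa using this
  op_self x y := by
    have := realize_of_forall_carrier (N := N) (α := Fin 2)
      ((childFormula (𝔵 0) (𝔵 1)).imp ((opTerm (𝔵 0) (𝔵 1) (𝔵 0)).equal (𝔵 1)))
      (fun v => by simpa using IsParentChild.op_self (v 0) (v 1)) ![x, y]
    simpa using this
  op_op x y z t := by
    have := realize_of_forall_carrier (N := N) (α := Fin 4)
      ((childFormula (𝔵 0) (𝔵 1)).imp ((parentFormula (𝔵 2)).imp ((parentFormula (𝔵 3)).imp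
        ((opTerm (𝔵 0) (opTerm (𝔵 0) (𝔵 1) (𝔵 2)) (𝔵 3)).equal
          (opTerm (𝔵 0) (𝔵 1) (opTerm (𝔵 0) (𝔵 2) (𝔵 3)))))))
      (fun v => by simpa using IsParentChild.op_op (v 0) (v 1) (v 2) (v 3)) ![x, y, z, t]
    simpa using this
  op_injective x y z t := by
    have := realize_of_forall_carrier (N := N) (α := Fin 4)
      ((childFormula (𝔵 0) (𝔵 1)).imp ((parentFormula (𝔵 2)).imp ((parentFormula (𝔵 3)).imp
        (((opTerm (𝔵 0) (𝔵 1) (𝔵 2)).equal (opTerm (𝔵 0) (𝔵 1) (𝔵 3))).imp ((𝔵 2).equal (𝔵 3))))))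
      (fun v => by simpa using IsParentChild.op_injective (v 0) (v 1) (v 2) (v 3)) ![x, y, z, t]
    simpa using this
  op_transitive x y y' := by
    have := realize_of_forall_carrier (N := N) (α := Fin 3)
      ((childFormula (𝔵 0) (𝔵 1)).imp ((childFormula (𝔵 0) (𝔵 2)).imp (Formula.iExs (Fin 1)
        (parentFormula (𝔵 (.inr 0)) ⊓
          (opTerm (𝔵 (.inl 0)) (𝔵 (.inl 1)) (𝔵 (.inr 0))).equal (𝔵 (.inl 2))))))
      (fun v => by
        simpa [Formula.realize_iExs, Fin.exists_fin_succ_pi, Fin.exists_fin_zero_pi] using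
          IsParentChild.op_transitive (v 0) (v 1) (v 2)) ![x, y, y']
    simpa [Formula.realize_iExs, Fin.exists_fin_succ_pi, Fin.exists_fin_zero_pi] using this
  op_children x y y' z := by
    have := realize_of_forall_carrier (N := N) (α := Fin 4)
      ((childFormula (𝔵 0) (𝔵 1)).imp ((childFormula (𝔵 0) (𝔵 2)).imp ((parentFormula (𝔵 3)).imp
        ((opTerm (𝔵 1) (opTerm (𝔵 0) (𝔵 1) (𝔵 3)) (𝔵 2)).equal (opTerm (𝔵 0) (𝔵 2) (𝔵 3))))))
      (fun v => by simpa using IsParentChild.op_children (v 0) (v 1) (v 2) (v 3)) ![x, y, y', z]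
    simpa using this
  op_parent_parent_child a b c := by
    have := realize_of_forall_carrier (N := N) (α := Fin 3)
      ((parentFormula (𝔵 0)).imp ((parentFormula (𝔵 1)).imp ((parentFormula (𝔵 2)).not.imp
        ((opTerm (𝔵 0) (𝔵 1) (𝔵 2)).equal (𝔵 2)))))
      (fun v => by simpa using IsParentChild.op_parent_parent_child (v 0) (v 1) (v 2)) ![a, b, c]
    simpa using this
  op_parent_child_child a b c := by
    have := realize_of_forall_carrier (N := N) (α := Fin 3)
      ((parentFormula (𝔵 0)).imp ((parentFormula (𝔵 1)).not.imp ((parentFormula (𝔵 2)).not.imp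
        ((opTerm (𝔵 0) (𝔵 1) (𝔵 2)).equal (𝔵 2)))))
      (fun v => by simpa using IsParentChild.op_parent_child_child (v 0) (v 1) (v 2)) ![a, b, c]
    simpa using this
  op_not_isChildOf a b c := by
    have := realize_of_forall_carrier (N := N) (α := Fin 3)
      ((parentFormula (𝔵 0)).imp ((parentFormula (𝔵 1)).not.imp ((parentFormula (𝔵 2)).imp
        ((childFormula (𝔵 0) (𝔵 1)).not.imp ((opTerm (𝔵 0) (𝔵 1) (𝔵 2)).equal (𝔵 2))))))
      (fun v => by simpa using IsParentChild.op_not_isChildOf (v 0) (v 1) (v 2)) ![a, b, c]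
    simpa using this
  op_child_parent a b c := by
    have := realize_of_forall_carrier (N := N) (α := Fin 3)
      ((parentFormula (𝔵 0)).not.imp ((parentFormula (𝔵 1)).imp
        ((opTerm (𝔵 0) (𝔵 1) (𝔵 2)).equal (𝔵 2))))
      (fun v => by simpa using IsParentChild.op_child_parent (v 0) (v 1) (v 2)) ![a, b, c]
    simpa using this
  op_child_child_parent a b c := by
    have := realize_of_forall_carrier (N := N) (α := Fin 3)
      ((parentFormula (𝔵 0)).not.imp ((parentFormula (𝔵 1)).not.imp ((parentFormula (𝔵 2)).imp
        ((opTerm (𝔵 0) (𝔵 1) (𝔵 2)).equal (𝔵 2)))))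
      (fun v => by simpa using IsParentChild.op_child_child_parent (v 0) (v 1) (v 2)) ![a, b, c]
    simpa using this
  op_not_siblings x a b c := by
    have := realize_of_forall_carrier (N := N) (α := Fin 4)
      ((parentFormula (𝔵 1)).not.imp ((parentFormula (𝔵 2)).not.imp ((childFormula (𝔵 0) (𝔵 3)).imp
        ((childFormula (𝔵 0) (𝔵 1) ⊓ childFormula (𝔵 0) (𝔵 2)).not.imp
          ((opTerm (𝔵 1) (𝔵 2) (𝔵 3)).equal (𝔵 3))))))
      (fun v => by
        simpa [-not_and] using IsParentChild.op_not_siblings (v 0) (v 1) (v 2) (v 3))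
      ![x, a, b, c]
    simpa [-not_and] using this

/-! ### The rational vector space of parents -/

section Parents

variable (N : Type*) [lang.Structure N]

/-- The sort of parents of a structure. -/
def Parents : Type _ := {x : N // IsParent x}

variable {N} [IsParentChild N]

instance : Zero (Parents N) := ⟨⟨zeroElt N, IsParentChild.isParent_zero⟩⟩

instance : One (Parents N) := ⟨⟨oneElt N, IsParentChild.isParent_one⟩⟩

instance : Add (Parents N) :=
  ⟨fun a b => ⟨op (zeroElt N) a.1 b.1,
    IsParentChild.isParent_op _ _ _ IsParentChild.isParent_zero a.2 b.2⟩⟩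

instance : Neg (Parents N) :=
  ⟨fun a => ⟨op a.1 (zeroElt N) (zeroElt N),
    IsParentChild.isParent_op _ _ _ a.2 IsParentChild.isParent_zero IsParentChild.isParent_zero⟩⟩

instance : AddCommGroup (Parents N) :=
  { AddGroup.ofLeftAxioms
      (fun a b c : Parents N => Subtype.ext (IsParentChild.add_assoc _ _ _ a.2 b.2 c.2))
      (fun a => Subtype.ext (IsParentChild.zero_add _ a.2))
      (fun a => Subtype.ext (IsParentChild.neg_add _ a.2)) with
    add_comm := fun a b => Subtype.ext (IsParentChild.add_comm _ _ a.2 b.2) }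

theorem Parents.op_val (a b c : Parents N) : op a.1 b.1 c.1 = (b - a + c).1 := by
  rw [sub_eq_add_neg]
  exact IsParentChild.op_parents _ _ _ a.2 b.2 c.2

theorem Parents.val_nsmul (n : ℕ) (a : Parents N) :
    (n • a).1 = (op (zeroElt N) a.1)^[n] (zeroElt N) := by
  induction n with
  | zero => rw [zero_nsmul]; rfl
  | succ n ih => rw [succ_nsmul', Function.iterate_succ_apply', ← ih]; rfl

theorem Parents.eq_zero_of_nsmul {n : ℕ} (hn : n ≠ 0) {a : Parents N} (h : n • a = 0) : a = 0 := by
  obtain ⟨m, rfl⟩ := Nat.exists_eq_succ_of_ne_zero hn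
  refine Subtype.ext (IsParentChild.torsionFree m a.1 a.2 ?_)
  rw [← Parents.val_nsmul, Nat.add_one, h]
  rfl

instance : IsAddTorsionFree (Parents N) where
  nsmul_right_injective n hn a b h := by
    rw [← sub_eq_zero]
    refine Parents.eq_zero_of_nsmul hn ?_
    rw [nsmul_sub, sub_eq_zero]
    exact h

theorem Parents.exists_nsmul_eq {n : ℕ} (hn : n ≠ 0) (a : Parents N) : ∃ b, n • b = a := by
  obtain ⟨m, rfl⟩ := Nat.exists_eq_succ_of_ne_zero hn
  obtain ⟨b, hb, h⟩ := IsParentChild.divisible m a.1 a.2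
  exact ⟨⟨b, hb⟩, Subtype.ext ((Parents.val_nsmul _ _).trans h)⟩

variable (N) in
/-- A torsion-free divisible group is its own divisible hull. -/
theorem Parents.divisibleHull_bijective :
    Function.Bijective (DivisibleHull.coeAddMonoidHom (Parents N)) := by
  refine ⟨DivisibleHull.coe_injective, fun x => ?_⟩
  induction x with
  | mk a n =>
    obtain ⟨b, hb⟩ := Parents.exists_nsmul_eq n.ne_zero a
    exact ⟨b, by simp [DivisibleHull.mk_eq_mk_iff_smul_eq_smul, hb]⟩

noncomputable instance : Module ℚ (Parents N) :=
  (AddEquiv.ofBijective _ (Parents.divisibleHull_bijective N)).module ℚ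

theorem Parents.one_ne_zero : (1 : Parents N) ≠ 0 := fun h =>
  IsParentChild.zero_ne_one (congrArg Subtype.val h).symm

end Parents

/-! ### Coordinates -/

/-- The structure with parents `V` and children `V × V`, where `V` is an abelian group in
which `u` is the element named by the constant `1`. It is a copy of the concrete structure for
`V = ℚ` and `u = 1`. -/
inductive Std (V : Type u) (u : V) : Type u
  | par (x : V) : Std V u
  | chi (x y : V) : Std V u

namespace Std

section Map

variable {V : Type*} {u : V} {W : Type*} {u' : W}

/-- The map of `Std V u` induced by a map of `V`. -/
def map (φ : V → W) : Std V u → Std W u'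
  | par p => par (φ p)
  | chi s q => chi (φ s) (φ q)

theorem map_injective {φ : V → W} (hφ : Function.Injective φ) :
    Function.Injective (map φ : Std V u → Std W u') := by
  rintro (p | ⟨s, q⟩) (p' | ⟨s', q'⟩) <;> simp [map, hφ.eq_iff]

theorem map_surjective {φ : V → W} (hφ : Function.Surjective φ) :
    Function.Surjective (map φ : Std V u → Std W u') := by
  rintro (p | ⟨s, q⟩)
  · obtain ⟨p, rfl⟩ := hφ p
    exact ⟨par p, rfl⟩
  · obtain ⟨s, rfl⟩ := hφ s
    obtain ⟨q, rfl⟩ := hφ q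
    exact ⟨chi s q, rfl⟩

end Map

variable {V : Type*} [AddCommGroup V] {u : V} {W : Type*} [AddCommGroup W] {u' : W}

open Classical in
/-- The interpretation of the ternary function symbol in `Std V u`. -/
noncomputable def stdOp : Std V u → Std V u → Std V u → Std V u
  | par p, par q, par r => par (q - p + r)
  | chi s p, chi s' q, chi s'' r => if s = s' ∧ s = s'' then chi s (q - p + r) else chi s'' r
  | par p, chi p' q, par r => if p = p' then chi p (q - p + r) else par r
  | _, _, c => c

/-- The interpretation of the relation symbol in `Std V u`. -/
def StdRel : Std V u → Std V u → Prop
  | par p, chi s _ => p = s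
  | _, _ => False

noncomputable instance : lang.Structure (Std V u) where
  funMap := fun {_} s =>
    match s with
    | Func.zero => fun _ => par 0
    | Func.one => fun _ => par u
    | Func.f => fun v => stdOp (v 0) (v 1) (v 2)
  RelMap := fun {_} s =>
    match s with
    | Rel.R => fun v => StdRel (v 0) (v 1)

theorem op_std (a b c : Std V u) : op a b c = stdOp a b c := rfl

theorem isChildOf_std (a b : Std V u) : IsChildOf a b ↔ StdRel a b := Iff.rfl

theorem map_stdOp (φ : V →+ W) (hφ : Function.Injective φ) (a b c : Std V u) :
    (map φ (stdOp a b c) : Std W u') = stdOp (map φ a) (map φ b) (map φ c) := by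
  have h (x y : V) : φ x = φ y ↔ x = y := hφ.eq_iff
  rcases a with p | ⟨s, p⟩ <;> rcases b with q | ⟨s', q⟩ <;> rcases c with r | ⟨s'', r⟩ <;>
    simp only [map, stdOp] <;> grind

theorem stdRel_map (φ : V →+ W) (hφ : Function.Injective φ) (a b : Std V u) :
    StdRel (map φ a : Std W u') (map φ b) ↔ StdRel a b := by
  rcases a with p | ⟨s, p⟩ <;> rcases b with q | ⟨s', q⟩ <;> simp [map, StdRel, hφ.eq_iff]

end Std

section Embeddings

variable {M N : Type*} [lang.Structure M] [lang.Structure N]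

/-- An injective map that respects the named operations is an embedding. -/
def embeddingOfOps (g : M → N) (hg : Function.Injective g)
    (zero : g (zeroElt M) = zeroElt N) (one : g (oneElt M) = oneElt N)
    (hop : ∀ a b c, g (op a b c) = op (g a) (g b) (g c))
    (hrel : ∀ a b, IsChildOf (g a) (g b) ↔ IsChildOf a b) : M ↪[lang] N where
  toFun := g
  inj' := hg
  map_fun' {n} s v := by
    cases s with
    | zero =>
      rw [Subsingleton.elim v ![], Subsingleton.elim (g ∘ _) ![] ]
      exact zero
    | one =>
      rw [Subsingleton.elim v ![], Subsingleton.elim (g ∘ _) ![] ]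
      exact one
    | f =>
      have h₁ : v = ![v 0, v 1, v 2] := by funext i; fin_cases i <;> rfl
      have h₂ : g ∘ v = ![g (v 0), g (v 1), g (v 2)] := by funext i; fin_cases i <;> rfl
      rw [h₂, h₁]
      exact hop _ _ _
  map_rel' {n} s v := by
    cases s with
    | R =>
      have h₁ : v = ![v 0, v 1] := by funext i; fin_cases i <;> rfl
      have h₂ : g ∘ v = ![g (v 0), g (v 1)] := by funext i; fin_cases i <;> rfl
      rw [h₂, h₁]
      exact hrel _ _

/-- A bijective embedding is an isomorphism. -/
noncomputable def equivOfEmbedding (g : M ↪[lang] N) (hg : Function.Surjective g) :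
    M ≃[lang] N where
  toEquiv := Equiv.ofBijective g ⟨g.injective, hg⟩
  map_fun' := g.map_fun
  map_rel' := g.map_rel

end Embeddings

namespace Std

variable {V : Type*} [AddCommGroup V] {u : V} {W : Type*} [AddCommGroup W] {u' : W}

/-- The embedding of standard structures induced by an injective homomorphism of groups. -/
noncomputable def mapEmbedding (φ : V →+ W) (hφ : Function.Injective φ) (hu : φ u = u') :
    Std V u ↪[lang] Std W u' :=
  embeddingOfOps (map φ) (map_injective hφ) (congrArg par (map_zero φ)) (congrArg par hu)
    (map_stdOp φ hφ) (stdRel_map φ hφ)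

/-- The isomorphism of standard structures induced by an isomorphism of groups. -/
noncomputable def mapEquiv (φ : V ≃+ W) (hu : φ u = u') : Std V u ≃[lang] Std W u' :=
  equivOfEmbedding (mapEmbedding φ.toAddMonoidHom φ.injective hu) (map_surjective φ.surjective)

/-- The multiples of `u` as a map from the concrete structure to `Std V u`. -/
def ofCarrier [Module ℚ V] : Carrier → Std V u
  | parent p => par (p • u)
  | child s q => chi (s • u) (q • u)

theorem ofCarrier_op [Module ℚ V] (hu : u ≠ 0) (a b c : Carrier) :
    (ofCarrier (op a b c) : Std V u) = op (ofCarrier a) (ofCarrier b) (ofCarrier c) := by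
  have h := smul_left_injective ℚ hu
  rw [op_carrier, op_std]
  rcases a with p | ⟨s, p⟩ <;> rcases b with q | ⟨s', q⟩ <;> rcases c with r | ⟨s'', r⟩ <;>
    simp only [fInterp, ofCarrier, stdOp, h.eq_iff] <;> (try split_ifs) <;>
    simp [add_smul, sub_smul]

/-- The concrete structure embeds in `Std V u`, if `V` is a rational vector space
and `u` is nonzero. -/
noncomputable def ofCarrierEmbedding [Module ℚ V] (hu : u ≠ 0) : Carrier ↪[lang] Std V u :=
  embeddingOfOps ofCarrier
    (by
      have h := smul_left_injective ℚ hu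
      rintro (p | ⟨s, q⟩) (p' | ⟨s', q'⟩) <;> simp [ofCarrier, h.eq_iff])
    (congrArg par (zero_smul ℚ u)) (congrArg par (one_smul ℚ u)) (ofCarrier_op hu)
    (by
      have h := smul_left_injective ℚ hu
      rintro (p | ⟨s, p⟩) (q | ⟨s', q⟩) <;> simp [ofCarrier, isChildOf_std, StdRel, h.eq_iff])

end Std

section Coordinates

variable {N : Type*} [lang.Structure N] [IsParentChild N]

/-- The element of `N` with given coordinates, relative to a choice of a child `b x` of every
parent `x`, where `b x` has the coordinates `(x, x)`. -/
def ofStd (b : Parents N → N) : Std (Parents N) (1 : Parents N) → N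
  | .par x => x.1
  | .chi x y => op x.1 (b x) y.1

variable {b : Parents N → N} (hb : ∀ x, IsChildOf x.1 (b x))
include hb

theorem isChildOf_ofStd (x y : Parents N) : IsChildOf x.1 (op x.1 (b x) y.1) :=
  IsParentChild.isChildOf_op _ _ _ (hb x) y.2

theorem not_isParent_ofStd (x y : Parents N) : ¬ IsParent (op x.1 (b x) y.1) :=
  IsParentChild.not_isParent_of_isChildOf _ _ (isChildOf_ofStd hb x y)

theorem isChildOf_ofStd_iff (z x y : Parents N) :
    IsChildOf z.1 (op x.1 (b x) y.1) ↔ z = x :=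
  ⟨fun h => Subtype.ext (IsParentChild.parent_unique _ _ _ h (isChildOf_ofStd hb x y)),
    fun h => h ▸ isChildOf_ofStd hb x y⟩

theorem ofStd_bijective : Function.Bijective (ofStd b) := by
  constructor
  · rintro (x | ⟨x, y⟩) (x' | ⟨x', y'⟩) h
    · exact congrArg Std.par (Subtype.ext h)
    · change x.1 = op x'.1 (b x') y'.1 at h
      exact absurd (h ▸ x.2) (not_isParent_ofStd hb x' y')
    · change op x.1 (b x) y.1 = x'.1 at h
      exact absurd (h ▸ x'.2) (not_isParent_ofStd hb x y)
    · change op x.1 (b x) y.1 = op x'.1 (b x') y'.1 at h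
      have hx : x = x' := by
        rw [← isChildOf_ofStd_iff hb x x' y', ← h]
        exact isChildOf_ofStd hb x y
      subst hx
      rw [Subtype.ext (IsParentChild.op_injective _ _ _ _ (hb x) y.2 y'.2 h)]
  · intro a
    by_cases ha : IsParent a
    · exact ⟨.par ⟨a, ha⟩, rfl⟩
    · obtain ⟨x, hx⟩ := IsParentChild.exists_parent a ha
      let x' : Parents N := ⟨x, IsParentChild.isParent_of_isChildOf _ _ hx⟩
      obtain ⟨z, hz, h⟩ := IsParentChild.op_transitive _ _ _ (hb x') hx
      exact ⟨.chi x' ⟨z, hz⟩, h⟩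

/-- The group operation acts on the second coordinate by translations. -/
theorem op_ofStd (x y z : Parents N) :
    op x.1 (op x.1 (b x) y.1) z.1 = op x.1 (b x) (y - x + z).1 := by
  rw [IsParentChild.op_op _ _ _ _ (hb x) y.2 z.2, Parents.op_val]

theorem op_siblings_ofStd (x p q r : Parents N) :
    op (op x.1 (b x) p.1) (op x.1 (b x) q.1) (op x.1 (b x) r.1) =
      op x.1 (b x) (q - p + r).1 := by
  have hq : op x.1 (b x) q.1 = op x.1 (op x.1 (b x) p.1) (q - p + x).1 := by
    rw [op_ofStd hb]
    congr 2
    abel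
  rw [hq, IsParentChild.op_children _ _ _ _ (isChildOf_ofStd hb x p) (isChildOf_ofStd hb x r)
    (q - p + x).2, op_ofStd hb]
  congr 2
  abel

theorem ofStd_op (a c d : Std (Parents N) (1 : Parents N)) :
    ofStd b (Std.stdOp a c d) = op (ofStd b a) (ofStd b c) (ofStd b d) := by
  rcases a with p | ⟨s, p⟩ <;> rcases c with q | ⟨s', q⟩ <;> rcases d with r | ⟨s'', r⟩
  · exact (Parents.op_val _ _ _).symm
  · exact (IsParentChild.op_parent_parent_child _ _ _ p.2 q.2 (not_isParent_ofStd hb _ _)).symm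
  · simp only [Std.stdOp]
    split_ifs with h
    · subst h
      exact (op_ofStd hb _ _ _).symm
    · refine (IsParentChild.op_not_isChildOf _ _ _ p.2 (not_isParent_ofStd hb _ _) r.2 ?_).symm
      exact fun h' => h ((isChildOf_ofStd_iff hb _ _ _).1 h')
  · exact (IsParentChild.op_parent_child_child _ _ _ p.2 (not_isParent_ofStd hb _ _)
      (not_isParent_ofStd hb _ _)).symm
  · exact (IsParentChild.op_child_parent _ _ _ (not_isParent_ofStd hb _ _) q.2).symm
  · exact (IsParentChild.op_child_parent _ _ _ (not_isParent_ofStd hb _ _) q.2).symm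
  · exact (IsParentChild.op_child_child_parent _ _ _ (not_isParent_ofStd hb _ _)
      (not_isParent_ofStd hb _ _) r.2).symm
  · simp only [Std.stdOp]
    split_ifs with h
    · obtain ⟨rfl, rfl⟩ := h
      exact (op_siblings_ofStd hb _ _ _ _).symm
    · refine (IsParentChild.op_not_siblings s''.1 _ _ _ (not_isParent_ofStd hb _ _)
        (not_isParent_ofStd hb _ _) (isChildOf_ofStd hb _ _) ?_).symm
      rintro ⟨h₁, h₂⟩
      have h₁' := (isChildOf_ofStd_iff hb _ _ _).1 h₁
      have h₂' := (isChildOf_ofStd_iff hb _ _ _).1 h₂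
      exact h ⟨h₁'.symm.trans h₂', h₁'.symm⟩

theorem isChildOf_ofStd_ofStd (a c : Std (Parents N) (1 : Parents N)) :
    IsChildOf (ofStd b a) (ofStd b c) ↔ Std.StdRel a c := by
  rcases c with q | ⟨s', q⟩
  · have h : ¬ IsChildOf (ofStd b a) (ofStd b (.par q)) := fun h =>
      IsParentChild.not_isParent_of_isChildOf _ _ h q.2
    rcases a with p | ⟨s, p⟩ <;> simpa [Std.StdRel] using h
  · rcases a with p | ⟨s, p⟩
    · exact isChildOf_ofStd_iff hb p s' q
    · have h : ¬ IsChildOf (ofStd b (.chi s p)) (ofStd b (.chi s' q)) := fun h =>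
        not_isParent_ofStd hb s p (IsParentChild.isParent_of_isChildOf _ _ h)
      simpa [Std.StdRel] using h

omit hb in
variable (N) in
/-- A structure that satisfies the axioms is determined by its vector space of parents. -/
theorem nonempty_std_equiv : Nonempty (Std (Parents N) (1 : Parents N) ≃[lang] N) := by
  choose b hb using fun x : Parents N => IsParentChild.exists_child x.1 x.2
  exact ⟨equivOfEmbedding (embeddingOfOps (ofStd b) (ofStd_bijective hb).1 rfl rfl (ofStd_op hb)
    (isChildOf_ofStd_ofStd hb)) (ofStd_bijective hb).2⟩

end Coordinates

/-! ### Uncountable categoricity -/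

section Categoricity

open Cardinal

instance infinite_parents (N : Type*) [lang.Structure N] [IsParentChild N] :
    Infinite (Parents N) :=
  Infinite.of_injective (fun q : ℚ => q • (1 : Parents N))
    (smul_left_injective ℚ Parents.one_ne_zero)

theorem mk_parents (N : Type u) [lang.Structure N] [IsParentChild N] : #(Parents N) = #N := by
  obtain ⟨e⟩ := nonempty_std_equiv N
  let e' : Std (Parents N) (1 : Parents N) ≃ Parents N ⊕ Parents N × Parents N :=
    { toFun := fun a => match a with
        | .par x => .inl x
        | .chi x y => .inr (x, y)
      invFun := Sum.elim .par fun p => .chi p.1 p.2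
      left_inv := by rintro (x | ⟨x, y⟩) <;> rfl
      right_inv := by rintro (x | ⟨x, y⟩) <;> rfl }
  have h := aleph0_le_mk (Parents N)
  rw [← mk_congr e.toEquiv, mk_congr e', mk_sum, mk_prod]
  simp only [lift_id]
  rw [mul_eq_self h, add_eq_self h]

/-- Linear equivalences act transitively on nonzero vectors. -/
theorem exists_linearEquiv_apply_eq {K V : Type*} [Field K] [AddCommGroup V] [Module K V]
    {x y : V} (hx : x ≠ 0) (hy : y ≠ 0) : ∃ φ : V ≃ₗ[K] V, φ x = y := by
  let f := (LinearEquiv.toSpanNonzeroSingleton K V x hx).symm ≪≫ₗ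
    LinearEquiv.toSpanNonzeroSingleton K V y hy
  obtain ⟨g, hg⟩ := Submodule.exists_linearEquiv_restrict_eq f
  refine ⟨g, ?_⟩
  have h : (LinearEquiv.toSpanNonzeroSingleton K V x hx).symm
      ⟨x, Submodule.mem_span_singleton_self x⟩ = 1 := by
    rw [LinearEquiv.symm_apply_eq, LinearEquiv.toSpanNonzeroSingleton_one]
  simpa [f, h] using (hg ⟨x, Submodule.mem_span_singleton_self x⟩).symm

theorem exists_equiv_parents {M N : Type u} [lang.Structure M] [lang.Structure N]
    [IsParentChild M] [IsParentChild N] (hM : ℵ₀ < #M) (hMN : #M = #N) :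
    ∃ φ : Parents M ≃ₗ[ℚ] Parents N, φ 1 = 1 := by
  have hrank : Module.rank ℚ (Parents M) = Module.rank ℚ (Parents N) := by
    rw [Module.Free.rank_eq_mk_of_infinite_lt, Module.Free.rank_eq_mk_of_infinite_lt, mk_parents,
      mk_parents, hMN]
    · simpa [mk_parents, ← hMN] using hM
    · simpa [mk_parents] using hM
  obtain ⟨φ⟩ := nonempty_linearEquiv_of_rank_eq hrank
  obtain ⟨ψ, hψ⟩ := exists_linearEquiv_apply_eq (K := ℚ)
    ((map_ne_zero_iff φ φ.injective).2 (Parents.one_ne_zero (N := M)))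
    (Parents.one_ne_zero (N := N))
  exact ⟨φ ≪≫ₗ ψ, hψ⟩

theorem nonempty_equiv_of_mk_eq {M N : Type u} [lang.Structure M] [lang.Structure N]
    [IsParentChild M] [IsParentChild N] (hM : ℵ₀ < #M) (hMN : #M = #N) :
    Nonempty (M ≃[lang] N) := by
  obtain ⟨φ, hφ⟩ := exists_equiv_parents hM hMN
  obtain ⟨eM⟩ := nonempty_std_equiv M
  obtain ⟨eN⟩ := nonempty_std_equiv N
  exact ⟨(eN.comp (Std.mapEquiv φ.toAddEquiv hφ)).comp eM.symm⟩

instance countable_carrier : Countable Carrier := by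
  refine Function.Injective.countable (β := ℚ ⊕ ℚ × ℚ)
    (f := fun a => match a with
      | parent p => .inl p
      | child s q => .inr (s, q)) ?_
  rintro (p | ⟨s, q⟩) (p' | ⟨s', q'⟩) <;> simp

instance infinite_carrier : Infinite Carrier :=
  Infinite.of_injective parent fun _ _ h => by simpa using h

theorem card_lang_le : lang.card ≤ ℵ₀ := by
  rw [card, mk_le_aleph0_iff]
  have h₁ : Countable (Σ n, lang.Functions n) := by
    refine Function.Injective.countable (β := ℕ)
      (f := fun s => match s with
        | ⟨_, Func.zero⟩ => 0
        | ⟨_, Func.one⟩ => 1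
        | ⟨_, Func.f⟩ => 2) ?_
    rintro ⟨_, _ | _ | _⟩ ⟨_, _ | _ | _⟩ <;> simp
  have h₂ : Countable (Σ n, lang.Relations n) := by
    refine Function.Injective.countable (β := Unit) (f := fun _ => ()) ?_
    rintro ⟨_, ⟨⟩⟩ ⟨_, ⟨⟩⟩ _
    rfl
  exact instCountableSum

theorem isUncountablyCategorical :
    IsUncountablyCategorical.{0, 0, w} (lang.completeTheory Carrier) := by
  refine fun κ hκ => ⟨?_, fun M N hM hN => ?_⟩
  · refine Theory.exists_model_card_eq ⟨Theory.ModelType.of _ Carrier, infinite_carrier⟩ κ hκ.le ?_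
    refine (lift_le.2 card_lang_le).trans ?_
    simpa using hκ.le
  · exact nonempty_equiv_of_mk_eq (hM ▸ hκ) (hM.trans hN.symm)

end Categoricity

/-! ### Translations of the concrete structure -/

/-- The map that translates the children of `s` by `t s`. -/
def translate (t : ℚ → ℚ) : Carrier → Carrier
  | parent p => parent p
  | child s q => child s (q + t s)

@[simp]
theorem translate_parent (t : ℚ → ℚ) (p : ℚ) : translate t (parent p) = parent p := rfl

@[simp]
theorem translate_child (t : ℚ → ℚ) (s q : ℚ) :
    translate t (child s q) = child s (q + t s) := rfl

/-- Translations are automorphisms. -/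
noncomputable def translation (t : ℚ → ℚ) : Carrier ≃[lang] Carrier :=
  equivOfEmbedding
    (embeddingOfOps (translate t)
      (by rintro (p | ⟨s, q⟩) (p' | ⟨s', q'⟩) <;> simp +contextual)
      rfl rfl
      (by
        rintro (p | ⟨s, p⟩) (q | ⟨s', q⟩) (r | ⟨s'', r⟩) <;>
          simp only [op_carrier, fInterp, translate] <;> (try split_ifs) <;> grind [translate])
      (by rintro (p | ⟨s, p⟩) (q | ⟨s', q⟩) <;> simp))
    (by
      rintro (p | ⟨s, q⟩)
      · exact ⟨parent p, rfl⟩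
      · exact ⟨child s (q - t s), congrArg (child s) (sub_add_cancel q (t s))⟩)

@[simp]
theorem translation_apply (t : ℚ → ℚ) (a : Carrier) : translation t a = translate t a := rfl

/-! ### Isolation of orbits -/

/-- The parent of a child, and a parent itself. -/
def root : Carrier → ℚ
  | parent p => p
  | child s _ => s

/-- The variable indexed by an element of the concrete structure. -/
def elemVar (a : Carrier) : lang.Term Carrier := Term.var a

@[simp]
theorem realize_elemVar {N : Type*} [lang.Structure N] (a : Carrier) (v : Carrier → N) :
    (elemVar a).realize v = v a := rfl

theorem isQF_equal {α : Type*} (s t : lang.Term α) : BoundedFormula.IsQF (s.equal t) :=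
  (BoundedFormula.IsAtomic.equal _ _).isQF

theorem isQF_childFormula {α : Type*} (s t : lang.Term α) :
    BoundedFormula.IsQF (childFormula s t) :=
  (BoundedFormula.IsAtomic.rel _ _).isQF

theorem exists_nat_mul_add_eq (p : ℚ) : ∃ n m k : ℕ, n ≠ 0 ∧ n * p + m = k := by
  refine ⟨p.den, p.num.natAbs, (p.num + p.num.natAbs).toNat, p.den_ne_zero, ?_⟩
  have h : ((p.num + p.num.natAbs).toNat : ℤ) = p.num + p.num.natAbs :=
    Int.toNat_of_nonneg (by omega)
  have h' := congrArg (Int.cast : ℤ → ℚ) h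
  rw [Int.cast_natCast, Int.cast_add, Int.cast_natCast] at h'
  rw [Rat.den_mul_eq_num, h']

/-- Rational parents are definable. The formula may use the children of the parent as well, since
variables are indexed by all elements. -/
theorem exists_formula_parent (p : ℚ) : ∃ ψ : lang.Formula Carrier, BoundedFormula.IsQF ψ ∧
    ψ.Realize (id : Carrier → Carrier) ∧
    ∀ v : Carrier → Carrier, ψ.Realize v → v (parent p) = parent p := by
  obtain ⟨n, m, k, hn, h⟩ := exists_nat_mul_add_eq p
  -- `n · p + m · 1 = k · 1`, and `p` has a child
  refine ⟨(mulAddTerm n (elemVar (parent p)) (mulAddTerm m oneTerm zeroTerm)).equal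
    (mulAddTerm k oneTerm zeroTerm) ⊓ childFormula (elemVar (parent p)) (elemVar (child p 0)),
    (isQF_equal _ _).inf (isQF_childFormula _ _), ?_, fun v hv => ?_⟩
  · simpa [iterate_op_carrier] using h
  · simp only [Formula.realize_inf, Formula.realize_equal, realize_mulAddTerm, realize_elemVar,
      realize_oneTerm, realize_zeroTerm, zeroElt_carrier, oneElt_carrier, realize_childFormula,
      iterate_op_carrier] at hv
    obtain ⟨hv₁, hv₂⟩ := hv
    rcases hp : v (parent p) with p' | ⟨s, q⟩
    · rw [hp, iterate_op_carrier] at hv₁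
      have h' : (n : ℚ) * p' + (m * 1 + 0) = k * 1 + 0 := by simpa using hv₁
      have : (n : ℚ) * p' = n * p := by linarith
      rw [mul_left_cancel₀ (Nat.cast_ne_zero.2 hn) this]
    · rw [hp] at hv₂
      exact absurd hv₂ (not_child_isChildOf _ _ _)

/-- Two children of the same parent can only be moved by a common translation. -/
theorem exists_formula_children (s q r : ℚ) : ∃ ψ : lang.Formula Carrier, BoundedFormula.IsQF ψ ∧
    ψ.Realize (id : Carrier → Carrier) ∧
    ∀ v : Carrier → Carrier, ψ.Realize v →
      ∃ t, v (child s q) = child s (q + t) ∧ v (child s r) = child s (r + t) := by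
  obtain ⟨ψ₁, hψ₁, hid₁, h₁⟩ := exists_formula_parent s
  obtain ⟨ψ₂, hψ₂, hid₂, h₂⟩ := exists_formula_parent (r - q + s)
  refine ⟨ψ₁ ⊓ ψ₂ ⊓ childFormula (elemVar (parent s)) (elemVar (child s q)) ⊓
    (opTerm (elemVar (parent s)) (elemVar (child s q)) (elemVar (parent (r - q + s)))).equal
      (elemVar (child s r)),
    ((hψ₁.inf hψ₂).inf (isQF_childFormula _ _)).inf (isQF_equal _ _), ?_, fun v hv => ?_⟩
  · simp [hid₁, hid₂]
  · simp only [Formula.realize_inf, realize_childFormula, realize_elemVar, Formula.realize_equal,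
      realize_opTerm] at hv
    obtain ⟨⟨⟨hv₁, hv₂⟩, hv₃⟩, hv₄⟩ := hv
    rw [h₁ v hv₁] at hv₃ hv₄
    rw [h₂ v hv₂] at hv₄
    rcases hq : v (child s q) with p | ⟨s', q'⟩
    · rw [hq] at hv₃
      exact absurd hv₃ (not_isChildOf_parent _ _)
    · rw [hq, isChildOf_parent_child] at hv₃
      subst hv₃
      rw [hq, op_parent_child_parent_carrier, if_pos rfl] at hv₄
      refine ⟨q' - q, by rw [add_sub_cancel], hv₄.symm.trans ?_⟩
      congr 1
      ring

theorem exists_formula_pair (a b : Carrier) : ∃ ψ : lang.Formula Carrier, BoundedFormula.IsQF ψ ∧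
    ψ.Realize (id : Carrier → Carrier) ∧
    ∀ v : Carrier → Carrier, ψ.Realize v → root a = root b →
      ∃ t : ℚ, v a = translate (fun _ => t) a ∧ v b = translate (fun _ => t) b := by
  rcases a with p | ⟨s, q⟩ <;> rcases b with p' | ⟨s', q'⟩
  · obtain ⟨ψ, hψ, hid, h⟩ := exists_formula_parent p
    refine ⟨ψ, hψ, hid, fun v hv hr => ⟨0, h v hv, ?_⟩⟩
    change p = p' at hr
    exact hr ▸ h v hv
  · obtain ⟨ψ₁, hψ₁, hid₁, h₁⟩ := exists_formula_parent p
    obtain ⟨ψ₂, hψ₂, hid₂, h₂⟩ := exists_formula_children s' q' q'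
    refine ⟨ψ₁ ⊓ ψ₂, hψ₁.inf hψ₂, by simp [hid₁, hid₂], fun v hv _ => ?_⟩
    rw [Formula.realize_inf] at hv
    obtain ⟨t, ht, -⟩ := h₂ v hv.2
    exact ⟨t, h₁ v hv.1, ht⟩
  · obtain ⟨ψ₁, hψ₁, hid₁, h₁⟩ := exists_formula_parent p'
    obtain ⟨ψ₂, hψ₂, hid₂, h₂⟩ := exists_formula_children s q q
    refine ⟨ψ₁ ⊓ ψ₂, hψ₁.inf hψ₂, by simp [hid₁, hid₂], fun v hv _ => ?_⟩
    rw [Formula.realize_inf] at hv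
    obtain ⟨t, ht, -⟩ := h₂ v hv.2
    exact ⟨t, ht, h₁ v hv.1⟩
  · obtain ⟨ψ, hψ, hid, h⟩ := exists_formula_children s q q'
    refine ⟨ψ, hψ, hid, fun v hv hr => ?_⟩
    change s = s' at hr
    subst hr
    exact h v hv

/-- A map on a set is the restriction of a translation, if it is so on pairs of elements
with the same root. -/
theorem exists_translate_of_pairs {ι : Type*} (a c : ι → Carrier)
    (h : ∀ i j, root (a i) = root (a j) →
      ∃ t : ℚ, c i = translate (fun _ => t) (a i) ∧ c j = translate (fun _ => t) (a j)) :
    ∃ t : ℚ → ℚ, ∀ i, c i = translate t (a i) := by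
  have hs (s : ℚ) : ∃ t : ℚ, ∀ i, root (a i) = s → c i = translate (fun _ => t) (a i) := by
    by_cases hc : ∃ i q, a i = child s q
    · obtain ⟨i, q, hi⟩ := hc
      obtain ⟨t, ht, -⟩ := h i i rfl
      refine ⟨t, fun j hj => ?_⟩
      obtain ⟨t', hi', hj'⟩ := h i j (by rw [hj, hi]; rfl)
      rw [ht, hi] at hi'
      have htt : t = t' := by simpa using hi'
      rw [htt]
      exact hj'
    · refine ⟨0, fun j hj => ?_⟩
      obtain ⟨t, ht, -⟩ := h j j rfl
      rcases haj : a j with p | ⟨s', q⟩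
      · rw [ht, haj]
        rfl
      · rw [haj] at hj
        change s' = s at hj
        exact absurd ⟨j, q, hj ▸ haj⟩ hc
  choose t ht using hs
  refine ⟨t, fun i => (ht _ i rfl).trans ?_⟩
  rcases a i with p | ⟨s, q⟩ <;> rfl

/-- The orbit of a finite tuple is isolated by a formula `ψ`, whose variables are indexed by the
elements of the concrete structure. It is preserved by embeddings, being quantifier-free. The
additional variables, which name the parents, take the place of existential quantifiers. -/
theorem exists_formula_orbit {n : ℕ} (a : Fin n → Carrier) :
    ∃ ψ : lang.Formula Carrier, (∀ (N : Type w) [lang.Structure N] (e : Carrier ↪[lang] N),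
      ψ.Realize e) ∧
    ∀ v : Carrier → Carrier, ψ.Realize v → ∃ g : Carrier ≃[lang] Carrier, v ∘ a = g ∘ a := by
  choose ψ hψ hid h using fun i j => exists_formula_pair (a i) (a j)
  refine ⟨Formula.iInf fun ij : Fin n × Fin n => ψ ij.1 ij.2, fun N _ e => ?_, fun v hv => ?_⟩
  · rw [Formula.realize_iInf]
    intro ij
    have := ((hψ ij.1 ij.2).realize_embedding e (v := id) (xs := default)).2 (hid ij.1 ij.2)
    rwa [Subsingleton.elim (e ∘ default : Fin 0 → N) default] at this
  · rw [Formula.realize_iInf] at hv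
    obtain ⟨t, ht⟩ := exists_translate_of_pairs a (v ∘ a) fun i j => h i j v (hv (i, j))
    exact ⟨translation t, funext ht⟩

/-! ### Primeness -/

theorem realize_of_embedding {N : Type w} [lang.Structure N] [N ⊨ lang.completeTheory Carrier]
    (e : Carrier ↪[lang] N) {n : ℕ} (φ : lang.Formula (Fin n)) (a : Fin n → Carrier)
    (h : φ.Realize a) : φ.Realize (e ∘ a) := by
  obtain ⟨ψ, hψ, horbit⟩ := exists_formula_orbit.{w} a
  have := realize_of_forall_carrier (N := N) (ψ.imp (φ.relabel a)) (fun v => by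
    rw [Formula.realize_imp, Formula.realize_relabel]
    intro hv
    obtain ⟨g, hg⟩ := horbit v hv
    rw [hg]
    exact (StrongHomClass.realize_formula g φ).2 h) e
  rw [Formula.realize_imp, Formula.realize_relabel] at this
  exact this (hψ N e)

/-- Every embedding of the concrete structure in a model of its theory is elementary. -/
def elementaryOfEmbedding {N : Type w} [lang.Structure N] [N ⊨ lang.completeTheory Carrier]
    (e : Carrier ↪[lang] N) : Carrier ↪ₑ[lang] N where
  toFun := e
  map_formula' n φ a := by
    refine ⟨fun h => ?_, realize_of_embedding e φ a⟩
    by_contra h'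
    exact realize_of_embedding e φ.not a h' h

theorem isPrimeModel : IsPrimeModel.{0, 0, w, 0} (lang.completeTheory Carrier) Carrier := by
  refine ⟨inferInstance, fun N => ?_⟩
  obtain ⟨e⟩ := nonempty_std_equiv N
  exact ⟨elementaryOfEmbedding
    (e.toEmbedding.comp (Std.ofCarrierEmbedding Parents.one_ne_zero))⟩

/-! ### The automorphism group -/

theorem map_op {M N : Type*} [lang.Structure M] [lang.Structure N] (g : M ≃[lang] N) (a b c : M) :
    g (op a b c) = op (g a) (g b) (g c) := by
  have h : g ∘ ![a, b, c] = ![g a, g b, g c] := by funext i; fin_cases i <;> rfl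
  rw [op, g.map_fun, h]
  rfl

theorem isChildOf_map {M N : Type*} [lang.Structure M] [lang.Structure N] (g : M ≃[lang] N)
    (a b : M) : IsChildOf (g a) (g b) ↔ IsChildOf a b := by
  have h : g ∘ ![a, b] = ![g a, g b] := by funext i; fin_cases i <;> rfl
  rw [IsChildOf, IsChildOf, ← g.map_rel, h]

/-- Automorphisms fix all parents, since each of them is definable. -/
theorem map_parent (g : Carrier ≃[lang] Carrier) (p : ℚ) : g (parent p) = parent p := by
  obtain ⟨ψ, hψ, hid, h⟩ := exists_formula_parent p
  refine h g ?_
  have := (hψ.realize_embedding g (v := id) (xs := default)).2 hid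
  rwa [Subsingleton.elim (g ∘ default : Fin 0 → Carrier) default] at this

/-- The second coordinate of a child; the value `0` at parents plays no role. -/
def coord : Carrier → ℚ
  | parent _ => 0
  | child _ q => q

/-- The amount by which an automorphism translates the children of `s`. -/
def shift (s : ℚ) (g : Carrier ≃[lang] Carrier) : ℚ :=
  coord (g (child s 0))

theorem map_child (g : Carrier ≃[lang] Carrier) (s q : ℚ) :
    g (child s q) = child s (q + shift s g) := by
  have h₀ : g (child s 0) = child s (shift s g) := by
    have h : IsChildOf (g (parent s)) (g (child s 0)) := (isChildOf_map g _ _).2 (by simp)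
    rw [map_parent] at h
    rw [shift]
    rcases hg : g (child s 0) with p | ⟨s', q'⟩
    · simp [hg] at h
    · have : s = s' := by simpa [hg] using h
      rw [this]
      rfl
  have h : op (parent s) (child s 0) (parent (q + s)) = child s q := by simp
  rw [← h, map_op, map_parent, map_parent, h₀, op_parent_child_parent_carrier, if_pos rfl]
  congr 1
  ring

theorem shift_mul (s : ℚ) (g h : Carrier ≃[lang] Carrier) :
    shift s (g * h) = shift s g + shift s h := by
  have e : (g * h) (child s 0) = g (h (child s 0)) := rfl
  rw [map_child, map_child, map_child] at e
  have : shift s (g * h) = shift s h + shift s g := by simpa using e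
  rw [this, add_comm]

theorem shift_translation (s : ℚ) (t : ℚ → ℚ) : shift s (translation t) = t s := zero_add _

theorem continuous_shift (s : ℚ) :
    Continuous fun g : Carrier ≃[lang] Carrier => (shift s g : ℝ) := by
  let _ : TopologicalSpace Carrier := ⊥
  have : DiscreteTopology Carrier := ⟨rfl⟩
  have h₁ : Continuous fun (g : Carrier ≃[lang] Carrier) (a : Carrier) => g a :=
    continuous_induced_dom
  have h₂ : Continuous fun a : Carrier => (coord a : ℝ) := continuous_of_discreteTopology
  exact h₂.comp ((continuous_apply (child s 0)).comp h₁)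

theorem isContinuousLeftInvariantPseudometric_shift (s : ℚ) :
    IsContinuousLeftInvariantPseudometric
      (fun g h : Carrier ≃[lang] Carrier => |(shift s g : ℝ) - shift s h|) where
  dist_self g := by simp
  dist_comm g h := abs_sub_comm _ _
  dist_triangle g h k := abs_sub_le _ _ _
  left_invariant g h k := by simp [shift_mul]
  continuous :=
    (((continuous_shift s).comp continuous_fst).sub ((continuous_shift s).comp continuous_snd)).abs

/-- Every neighbourhood of the identity contains the pointwise stabilizer of a finite set. -/
theorem exists_finset_of_isOpen {U : Set (Carrier ≃[lang] Carrier)} (hU : IsOpen U)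
    (h1 : 1 ∈ U) : ∃ F : Finset Carrier, ∀ g : Carrier ≃[lang] Carrier,
      (∀ a ∈ F, g a = a) → g ∈ U := by
  let _ : TopologicalSpace Carrier := ⊥
  have : DiscreteTopology Carrier := ⟨rfl⟩
  obtain ⟨V, hV, rfl⟩ := isOpen_induced_iff.1 hU
  obtain ⟨F, u, hu, hF⟩ := isOpen_pi_iff.1 hV _ h1
  refine ⟨F, fun g hg => hF fun a ha => ?_⟩
  change g a ∈ u a
  rw [hg a ha]
  exact (hu a ha).2

theorem not_isLocallyOB : ¬ IsLocallyOB (Carrier ≃[lang] Carrier) := by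
  rintro ⟨U, hU, h1, hOB⟩
  obtain ⟨F, hF⟩ := exists_finset_of_isOpen hU h1
  obtain ⟨s, hs⟩ := Infinite.exists_notMem_finset (F.image root)
  obtain ⟨C, hC⟩ := hOB _ (isContinuousLeftInvariantPseudometric_shift s)
  -- Translations of the children of `s` alone fix `F` and are arbitrarily long.
  have hmem (c : ℚ) : translation (Pi.single s c) ∈ U := by
    refine hF _ fun a ha => ?_
    rcases a with p | ⟨s', q⟩
    · rfl
    · have hne : s' ≠ s := fun h => hs (Finset.mem_image.2 ⟨_, ha, h⟩)
      simp [hne]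
  obtain ⟨n, hn⟩ := exists_nat_gt C
  have := hC _ (hmem n) _ (hmem 0)
  simp only [shift_translation, Pi.single_eq_same] at this
  rw [Rat.cast_natCast, Rat.cast_zero, sub_zero, Nat.abs_cast] at this
  exact absurd hn this.not_gt

end ParentChild

theorem theorem1 :
    Countable ParentChild.Carrier ∧
    FirstOrder.Language.IsUncountablyCategorical.{0, 0, w}
      (ParentChild.lang.completeTheory ParentChild.Carrier) ∧
    FirstOrder.Language.IsPrimeModel.{0, 0, w, 0}
      (ParentChild.lang.completeTheory ParentChild.Carrier) ParentChild.Carrier ∧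
    ¬ IsLocallyOB (ParentChild.Carrier ≃[ParentChild.lang] ParentChild.Carrier) :=
  ⟨ParentChild.countable_carrier, ParentChild.isUncountablyCategorical, ParentChild.isPrimeModel,
    ParentChild.not_isLocallyOB⟩
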